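/- All graphs are finite and simple. For integers $n\ge m\ge 0$, the double star $S(n,m)$ is the graph obtained from the disjoint union of the two stars $K_{1,n}$ and $K_{1,m}$ by adding an edge between their centers. For graphs $G$ and $H$ and an integer $k\ge 1$, the $k$-colored Gallai–Ramsey number $gr_k(G:H)$ is the minimum integer $N$ such that every coloring of the edges of the complete graph $K_N$ with colors from $\{1,\dots,k\}$ (not all of which need be used) contains a copy of $G$ no two edges of which have the same color (a rainbow copy) or a copy of $H$ all of whose edges have the same color (a monochromatic copy). Copies are subgraphs, not necessarily induced. **Theorem.** Let $n,m,k$ be integers with $m\ge 1$, $k\ge 3$ and $n\ge 6m+7$. Then $$ gr_k(K_3:S(n,m))=\begin{cases} 5\cdot\dfrac{n}{2}+m(k-3)+1 & \text{if } n \text{ is even},\\[2mm] 5\cdot\dfrac{n-1}{2}+m(k-3)+2 & \text{if } n \text{ is odd}. \end{cases} $$ -/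

import Mathlib

/-- The double star `S(n,m)`: the disjoint union of the stars `K_{1,n}` and `K_{1,m}`, together
with one more edge, joining the two centres. -/
def doubleStar (n m : ℕ) : SimpleGraph ((Unit ⊕ Fin n) ⊕ (Unit ⊕ Fin m)) :=
  (SimpleGraph.sum (completeBipartiteGraph Unit (Fin n)) (completeBipartiteGraph Unit (Fin m))) ⊔
    SimpleGraph.edge (Sum.inl (Sum.inl ())) (Sum.inr (Sum.inl ()))

/-- The edge colouring `C` of the complete graph on `V` contains a rainbow copy of `G`: a copy
of `G` no two edges of which have the same colour. -/
def HasRainbowCopy {V K α : Type*} (C : SimpleGraph.TopEdgeLabeling V K)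
    (G : SimpleGraph α) : Prop :=
  ∃ f : SimpleGraph.Copy G (⊤ : SimpleGraph V),
    Function.Injective fun e : G.edgeSet => C (f.mapEdgeSet e)

/-- The edge colouring `C` of the complete graph on `V` contains a monochromatic copy of `H`: for
some colour `i`, the graph of the edges of colour `i` contains a copy of `H` as a subgraph. -/
def HasMonochromaticCopy {V K α : Type*} (C : SimpleGraph.TopEdgeLabeling V K)
    (H : SimpleGraph α) : Prop :=
  ∃ i : K, SimpleGraph.IsContained H (C.labelGraph i)

/-- `N` is the `k`-coloured Gallai-Ramsey number `gr_k(G : H)`: the minimum number of vertices such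
that every `k`-colouring of the edges of the complete graph on `N` vertices contains a rainbow copy
of `G` or a monochromatic copy of `H`. -/
def IsGallaiRamseyNumber {α β : Type*} (k : ℕ) (G : SimpleGraph α) (H : SimpleGraph β)
    (N : ℕ) : Prop :=
  IsLeast {M : ℕ | ∀ C : SimpleGraph.TopEdgeLabeling (Fin M) (Fin k),
    HasRainbowCopy C G ∨ HasMonochromaticCopy C H} N

/-!
Put `q = ⌊n/2⌋` and `ε = n mod 2`. Both cases of the formula read `5q + ε + m(k - 3) + 1`.

*Lower bound.* Blow up the `2`-coloured `K₅` without monochromatic triangle into classes of sizes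
`q + ε, q, q, q, q`, with a third colour inside the classes: all degrees are at most `n`. Then add
`k - 3` blocks of `m` vertices, each joined in a colour of its own to everything before. In these
colours one end of each edge has degree at most `m`. See `exists_coloring_of_le`.

*Upper bound.* An edge `xy` of colour `i` is the central edge of a monochromatic `S(n,m)` as soon as
`x` and `y` have at least `n + 1` and `m + 1` neighbours in colour `i` and the two neighbourhoods
cover `n + m + 2` vertices (`DoubleStarFree`). Suppose that this never happens. Let `H` be a
smallest module with at least `n + m + 1` vertices, a module being a set that each outer vertex sees in a
single colour. A colour in which some outer vertex sees `H` is an *outer colour*; it is used for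
at most `m` outer vertices, and has degrees at most `m` at the vertices of `H`
(`card_colorNbrs_le_of_mem_outerColors`). So `H` misses at most `m` vertices per outer colour,
and has at least `2n + 3` vertices, which is where `n ≥ 6m + 7` enters.

By Gallai's theorem (`IsGallaiColoring.exists_two_color_cut`), `H` is partitioned into classes that
are joined to each other in one of two colours `r` and `b`. The classes are smaller modules, so they
have at most `n + m` vertices. Counting with the double star condition then shows that neither
`r` nor `b` is an outer colour (`IsGallaiPartition.exists_lt_card_colorNbrs`), that all degrees in
these two colours exceed `m` (`IsGallaiPartition.lt_card_colorNbrs`), and hence that they are at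
most `n` (`IsGallaiPartition.card_colorNbrs_le`). Therefore each class has at least `|H| - 2n` vertices,
no class is joined to three others in the same colour, and two classes joined in one colour have a
common neighbour class in the other colour. This leaves only five classes, joined along two
complementary pentagons (`IsGallaiPartition.exists_pentagon`), any two of them having together at
most `n` vertices, so `|H| ≤ 5q + ε`. This suffices if there are at most `k - 3` outer colours.
Otherwise all colours but `r` and `b` are outer colours. As some colour has a vertex of degree at
least `2p/5` in any Gallai colouring of `p` vertices (`IsGallaiColoring.two_mul_card_le`), each
class with more than `5m/2` vertices has degrees above `m` in colour `r` or `b` inside it, and the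
resulting loss in the degree bounds makes up for the additional outer colour
(`false_of_pentagon_sizes`).
-/

/-! ### Colourings as symmetric functions -/

/-- The vertices of `S`, other than `x` itself, that are joined to `x` by an edge of colour `i`. -/
def colorNbrs {V K : Type*} [DecidableEq V] [DecidableEq K] (c : V → V → K) (S : Finset V)
    (i : K) (x : V) : Finset V :=
  S.filter fun y => y ≠ x ∧ c x y = i

lemma mem_colorNbrs {V K : Type*} [DecidableEq V] [DecidableEq K] {c : V → V → K} {S : Finset V}
    {i : K} {x y : V} : y ∈ colorNbrs c S i x ↔ y ∈ S ∧ y ≠ x ∧ c x y = i := by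
  simp [colorNbrs]

/-- A Gallai colouring, given as a symmetric function (with irrelevant values on the diagonal):
no triangle is rainbow. -/
structure IsGallaiColoring {V K : Type*} (c : V → V → K) : Prop where
  symm : ∀ x y, c x y = c y x
  triangle : ∀ x y z, x ≠ y → y ≠ z → x ≠ z → c x y = c y z ∨ c x y = c x z ∨ c x z = c y z

/-- The absence of a monochromatic double star in terms of neighbourhoods: if `xy` has colour `i`,
`x` has at least `n + 1` and `y` at least `m + 1` neighbours in colour `i`, then these
neighbourhoods together cover at most `n + m + 1` vertices. -/
def DoubleStarFree {V K : Type*} [DecidableEq V] [DecidableEq K] (c : V → V → K) (S : Finset V)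
    (n m : ℕ) : Prop :=
  ∀ x ∈ S, ∀ y ∈ S, x ≠ y → n + 1 ≤ (colorNbrs c S (c x y) x).card →
    m + 1 ≤ (colorNbrs c S (c x y) y).card →
    (colorNbrs c S (c x y) x ∪ colorNbrs c S (c x y) y).card ≤ n + m + 1

/-- Disjoint sets of `n` and `m` elements can be chosen from `X` and `Y` as soon as the obvious
counting conditions hold. -/
lemma exists_disjoint_subsets_card {V : Type*} [DecidableEq V] {X Y : Finset V} {n m : ℕ}
    (hX : n ≤ X.card) (hY : m ≤ Y.card) (hXY : n + m ≤ (X ∪ Y).card) :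
    ∃ A ⊆ X, ∃ B ⊆ Y, A.card = n ∧ B.card = m ∧ Disjoint A B := by
  by_cases h : n ≤ (X \ Y).card
  · obtain ⟨A, hA, hAc⟩ := Finset.exists_subset_card_eq h
    obtain ⟨B, hB, hBc⟩ := Finset.exists_subset_card_eq hY
    refine ⟨A, hA.trans Finset.sdiff_subset, B, hB, hAc, hBc, ?_⟩
    rw [Finset.disjoint_left]
    intro a ha hb
    exact (Finset.mem_sdiff.1 (hA ha)).2 (hB hb)
  · obtain ⟨A, hA1, hA2, hAc⟩ := Finset.exists_subsuperset_card_eq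
      (Finset.sdiff_subset : X \ Y ⊆ X) (by omega) hX
    have h1 : X ∪ Y ⊆ A ∪ (Y \ A) := by
      intro a ha
      by_cases haA : a ∈ A
      · simp [haA]
      · have : a ∉ X \ Y := fun h => haA (hA1 h)
        simp only [Finset.mem_union, Finset.mem_sdiff] at *
        tauto
    have h2 := (Finset.card_le_card h1).trans (Finset.card_union_le _ _)
    obtain ⟨B, hB, hBc⟩ := Finset.exists_subset_card_eq (show m ≤ (Y \ A).card by omega)
    refine ⟨A, hA2, B, hB.trans Finset.sdiff_subset, hAc, hBc, ?_⟩
    rw [Finset.disjoint_left]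
    intro a ha hb
    exact (Finset.mem_sdiff.1 (hB hb)).2 ha

/-- A graph with an edge `uv` and disjoint sets of `n` further neighbours of `u` and `m` further
neighbours of `v` contains `S(n,m)`. -/
lemma isContained_doubleStar {V : Type*} {G : SimpleGraph V} {n m : ℕ} {u v : V} (huv : G.Adj u v)
    {A B : Finset V} (hA : A.card = n) (hB : B.card = m) (hAB : Disjoint A B)
    (huA : ∀ a ∈ A, G.Adj u a ∧ a ≠ v) (hvB : ∀ b ∈ B, G.Adj v b ∧ b ≠ u) :
    (doubleStar n m).IsContained G := by
  subst hA hB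
  let f : (Unit ⊕ Fin A.card) ⊕ (Unit ⊕ Fin B.card) → V :=
    Sum.elim (Sum.elim (fun _ => u) fun j => (A.equivFin.symm j : V))
      (Sum.elim (fun _ => v) fun j => (B.equivFin.symm j : V))
  have hfA : ∀ j, f (Sum.inl (Sum.inr j)) ∈ A := fun j => (A.equivFin.symm j).2
  have hfB : ∀ j, f (Sum.inr (Sum.inr j)) ∈ B := fun j => (B.equivFin.symm j).2
  have hinj : Function.Injective f := by
    have hAB' : ∀ j l, f (Sum.inl (Sum.inr j)) ≠ f (Sum.inr (Sum.inr l)) := fun j l h =>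
      Finset.disjoint_left.1 hAB (hfA j) (h ▸ hfB l)
    have hA1 : ∀ j, f (Sum.inl (Sum.inr j)) ≠ u := fun j h => (huA _ (hfA j)).1.ne h.symm
    have hA2 : ∀ j, f (Sum.inl (Sum.inr j)) ≠ v := fun j => (huA _ (hfA j)).2
    have hB1 : ∀ j, f (Sum.inr (Sum.inr j)) ≠ v := fun j h => (hvB _ (hfB j)).1.ne h.symm
    have hB2 : ∀ j, f (Sum.inr (Sum.inr j)) ≠ u := fun j => (hvB _ (hfB j)).2
    rintro ((_ | j) | (_ | j)) ((_ | l) | (_ | l)) h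
    · rfl
    · exact absurd h.symm (hA1 l)
    · exact absurd h huv.ne
    · exact absurd h.symm (hB2 l)
    · exact absurd h (hA1 j)
    · have : j = l := A.equivFin.symm.injective (Subtype.ext h)
      rw [this]
    · exact absurd h (hA2 j)
    · exact absurd h (hAB' j l)
    · exact absurd h.symm huv.ne
    · exact absurd h.symm (hA2 l)
    · rfl
    · exact absurd h.symm (hB1 l)
    · exact absurd h (hB2 j)
    · exact absurd h.symm (hAB' l j)
    · exact absurd h (hB1 j)
    · have : j = l := B.equivFin.symm.injective (Subtype.ext h)
      rw [this]
  refine ⟨⟨⟨f, ?_⟩, hinj⟩⟩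
  have hu : f (Sum.inl (Sum.inl ())) = u := rfl
  have hv : f (Sum.inr (Sum.inl ())) = v := rfl
  rintro ((_ | j) | (_ | j)) ((_ | l) | (_ | l)) h <;>
    simp only [doubleStar, SimpleGraph.sup_adj, SimpleGraph.sum_adj, SimpleGraph.edge_adj,
      completeBipartiteGraph_adj] at h <;> simp at h
  · exact (huA _ (hfA l)).1
  · exact huv
  · exact (huA _ (hfA j)).1.symm
  · exact huv.symm
  · exact (hvB _ (hfB l)).1
  · exact (hvB _ (hfB j)).1.symm

/-- The colour function of an edge labelling of a complete graph; the diagonal gets the value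
`d`. -/
def labelFun {V K : Type*} [DecidableEq V] (C : SimpleGraph.TopEdgeLabeling V K) (d : K)
    (x y : V) : K :=
  if h : x ≠ y then SimpleGraph.EdgeLabeling.get C x y h else d

lemma labelFun_of_ne {V K : Type*} [DecidableEq V] (C : SimpleGraph.TopEdgeLabeling V K) (d : K)
    {x y : V} (h : x ≠ y) : labelFun C d x y = SimpleGraph.EdgeLabeling.get C x y h := by
  simp [labelFun, h]

lemma labelGraph_adj_iff_labelFun {V K : Type*} [DecidableEq V]
    (C : SimpleGraph.TopEdgeLabeling V K) (d : K) {x y : V} {i : K} :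
    (C.labelGraph i).Adj x y ↔ x ≠ y ∧ labelFun C d x y = i := by
  rw [SimpleGraph.TopEdgeLabeling.labelGraph_adj]
  constructor
  · rintro ⟨h, rfl⟩
    exact ⟨h, labelFun_of_ne C d h⟩
  · rintro ⟨h, rfl⟩
    exact ⟨h, (labelFun_of_ne C d h).symm⟩

lemma isGallaiColoring_labelFun {V K : Type*} [DecidableEq V] {C : SimpleGraph.TopEdgeLabeling V K}
    (hC : ¬ HasRainbowCopy C (⊤ : SimpleGraph (Fin 3))) (d : K) :
    IsGallaiColoring (labelFun C d) where
  symm x y := by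
    by_cases h : x = y
    · rw [h]
    · rw [labelFun_of_ne C d h, labelFun_of_ne C d (Ne.symm h)]
      exact SimpleGraph.EdgeLabeling.get_comm _ _ _
  triangle x y z hxy hyz hxz := by
    by_contra! hcon
    obtain ⟨h1, h2, h3⟩ := hcon
    rw [labelFun_of_ne C d hxy, labelFun_of_ne C d hyz] at h1
    rw [labelFun_of_ne C d hxy, labelFun_of_ne C d hxz] at h2
    rw [labelFun_of_ne C d hxz, labelFun_of_ne C d hyz] at h3
    refine hC ⟨⟨⟨![x, y, z], ?_⟩, ?_⟩, ?_⟩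
    · intro a b hab
      fin_cases a <;> fin_cases b <;> simp_all [Ne.symm]
    · intro a b hab
      fin_cases a <;> fin_cases b <;> simp_all [Ne.symm]
    · rintro ⟨e, he⟩ ⟨e', he'⟩ hee
      have key : ∀ e ∈ (⊤ : SimpleGraph (Fin 3)).edgeSet,
          e = s(0, 1) ∨ e = s(1, 2) ∨ e = s(0, 2) := by
        decide
      rcases key e he with rfl | rfl | rfl <;> rcases key e' he' with rfl | rfl | rfl
      · rfl
      · exact absurd hee h1
      · exact absurd hee h2
      · exact absurd hee.symm h1
      · rfl
      · exact absurd hee.symm h3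
      · exact absurd hee.symm h2
      · exact absurd hee h3
      · rfl

lemma doubleStarFree_labelFun {V K : Type*} [DecidableEq V] [Fintype V] [DecidableEq K]
    {C : SimpleGraph.TopEdgeLabeling V K} {n m : ℕ}
    (hC : ¬ HasMonochromaticCopy C (doubleStar n m)) (d : K) :
    DoubleStarFree (labelFun C d) Finset.univ n m := by
  intro u _ v _ huv hu hv
  by_contra! hcon
  set i := labelFun C d u v with hi
  have hsymm : labelFun C d v u = i := by
    rw [hi, labelFun_of_ne C d huv, labelFun_of_ne C d huv.symm]
    exact SimpleGraph.EdgeLabeling.get_comm _ _ _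
  set X := colorNbrs (labelFun C d) Finset.univ i u
  set Y := colorNbrs (labelFun C d) Finset.univ i v
  have hvX : v ∈ X := mem_colorNbrs.2 ⟨Finset.mem_univ _, huv.symm, hi.symm⟩
  have huY : u ∈ Y := mem_colorNbrs.2 ⟨Finset.mem_univ _, huv, hsymm⟩
  have h1 : X ∪ Y ⊆ insert u (insert v (X.erase v ∪ Y.erase u)) := by
    intro a ha
    by_cases h1 : a = u
    · simp [h1]
    by_cases h2 : a = v
    · simp [h2]
    simpa [h1, h2] using ha
  have h2 := (Finset.card_le_card h1).trans (Finset.card_insert_le _ _)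
  have h3 := Finset.card_insert_le v (X.erase v ∪ Y.erase u)
  obtain ⟨A, hA, B, hB, hAc, hBc, hAB⟩ := exists_disjoint_subsets_card
    (X := X.erase v) (Y := Y.erase u) (n := n) (m := m)
    (by rw [Finset.card_erase_of_mem hvX]; omega) (by rw [Finset.card_erase_of_mem huY]; omega)
    (by omega)
  refine hC ⟨i, isContained_doubleStar (u := u) (v := v) ?_ hAc hBc hAB ?_ ?_⟩
  · exact (labelGraph_adj_iff_labelFun C d).2 ⟨huv, hi.symm⟩
  · intro a ha
    obtain ⟨h1, h2⟩ := Finset.mem_erase.1 (hA ha)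
    obtain ⟨-, h3, h4⟩ := mem_colorNbrs.1 h2
    exact ⟨(labelGraph_adj_iff_labelFun C d).2 ⟨h3.symm, h4⟩, h1⟩
  · intro a ha
    obtain ⟨h1, h2⟩ := Finset.mem_erase.1 (hB ha)
    obtain ⟨-, h3, h4⟩ := mem_colorNbrs.1 h2
    exact ⟨(labelGraph_adj_iff_labelFun C d).2 ⟨h3.symm, h4⟩, h1⟩

/-- The centres of a copy of `S(n,m)` have degrees at least `n + 1` and `m + 1`. -/
lemma exists_card_le_of_isContained_doubleStar {V : Type*} {G : SimpleGraph V} {n m : ℕ}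
    (h : (doubleStar n m).IsContained G) :
    ∃ u v, G.Adj u v ∧ (∃ A : Finset V, A.card = n + 1 ∧ ∀ a ∈ A, G.Adj u a) ∧
      ∃ B : Finset V, B.card = m + 1 ∧ ∀ b ∈ B, G.Adj v b := by
  classical
  obtain ⟨f⟩ := h
  have huv : (doubleStar n m).Adj (Sum.inl (Sum.inl ())) (Sum.inr (Sum.inl ())) := by
    simp [doubleStar, SimpleGraph.edge_adj]
  have hu : ∀ j, (doubleStar n m).Adj (Sum.inl (Sum.inl ())) (Sum.inl (Sum.inr j)) := by
    simp [doubleStar]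
  have hv : ∀ j, (doubleStar n m).Adj (Sum.inr (Sum.inl ())) (Sum.inr (Sum.inr j)) := by
    simp [doubleStar]
  refine ⟨f (Sum.inl (Sum.inl ())), f (Sum.inr (Sum.inl ())), f.toHom.map_adj huv,
    ⟨Finset.univ.image fun o : Option (Fin n) =>
      f (o.elim (Sum.inr (Sum.inl ())) fun j => Sum.inl (Sum.inr j)), ?_, ?_⟩,
    ⟨Finset.univ.image fun o : Option (Fin m) =>
      f (o.elim (Sum.inl (Sum.inl ())) fun j => Sum.inr (Sum.inr j)), ?_, ?_⟩⟩
  · rw [Finset.card_image_of_injective]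
    · simp
    · rintro (_ | j) (_ | l) h <;> have := f.injective h <;> simp_all
  · simp only [Finset.mem_image, Finset.mem_univ, true_and, forall_exists_index,
      forall_apply_eq_imp_iff]
    rintro (_ | j)
    · exact f.toHom.map_adj huv
    · exact f.toHom.map_adj (hu j)
  · rw [Finset.card_image_of_injective]
    · simp
    · rintro (_ | j) (_ | l) h <;> have := f.injective h <;> simp_all
  · simp only [Finset.mem_image, Finset.mem_univ, true_and, forall_exists_index,
      forall_apply_eq_imp_iff]
    rintro (_ | j)
    · exact f.toHom.map_adj huv.symm
    · exact f.toHom.map_adj (hv j)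

lemma not_hasRainbowCopy_of_forall {V K : Type*} {C : SimpleGraph.TopEdgeLabeling V K}
    (h : ∀ (x y z : V) (hxy : x ≠ y) (hyz : y ≠ z) (hxz : x ≠ z),
      C.get x y hxy = C.get y z hyz ∨ C.get x y hxy = C.get x z hxz ∨
        C.get x z hxz = C.get y z hyz) :
    ¬ HasRainbowCopy C (⊤ : SimpleGraph (Fin 3)) := by
  rintro ⟨f, hf⟩
  have hne : ∀ {a b : Fin 3}, a ≠ b → f a ≠ f b := fun hab h => hab (f.injective h)
  have h01 : s((0 : Fin 3), 1) ∈ (⊤ : SimpleGraph (Fin 3)).edgeSet := by decide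
  have h12 : s((1 : Fin 3), 2) ∈ (⊤ : SimpleGraph (Fin 3)).edgeSet := by decide
  have h02 : s((0 : Fin 3), 2) ∈ (⊤ : SimpleGraph (Fin 3)).edgeSet := by decide
  rcases h (f 0) (f 1) (f 2) (hne (by decide)) (hne (by decide)) (hne (by decide)) with h | h | h
  · have := @hf ⟨_, h01⟩ ⟨_, h12⟩ h
    exact absurd (congrArg Subtype.val this)
      (show s((0 : Fin 3), 1) ≠ s(1, 2) by decide)
  · have := @hf ⟨_, h01⟩ ⟨_, h02⟩ h
    exact absurd (congrArg Subtype.val this)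
      (show s((0 : Fin 3), 1) ≠ s(0, 2) by decide)
  · have := @hf ⟨_, h02⟩ ⟨_, h12⟩ h
    exact absurd (congrArg Subtype.val this)
      (show s((0 : Fin 3), 2) ≠ s(1, 2) by decide)

/-! ### The extremal colouring -/

/-- The layer of the vertex `x` in the extremal colouring: the first `t` vertices form layer `0`,
and each following block of `m` vertices forms a further layer. -/
def extremalLayer (t m x : ℕ) : ℕ :=
  if x < t then 0 else (x - t) / m + 1

/-- The extremal colouring. Layer `0` is split into the residue classes mod `5`, which are joined
by colours `0` and `1` along two complementary `5`-cycles; layer `j ≥ 1` is joined to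
all earlier layers by colour `j + 2`; everything else has colour `2`. -/
def extremalColor (t m x y : ℕ) : ℕ :=
  if extremalLayer t m x ≠ extremalLayer t m y then
    max (extremalLayer t m x) (extremalLayer t m y) + 2
  else if extremalLayer t m x = 0 ∧ x % 5 ≠ y % 5 then
    if (x + 1) % 5 = y % 5 ∨ (y + 1) % 5 = x % 5 then 0 else 1
  else 2

lemma extremalColor_comm (t m x y : ℕ) : extremalColor t m x y = extremalColor t m y x := by
  unfold extremalColor
  grind

lemma extremalLayer_le {t m x j : ℕ} (hx : x < t + m * j) : extremalLayer t m x ≤ j := by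
  unfold extremalLayer
  split_ifs with h
  · exact Nat.zero_le _
  · exact Nat.div_lt_of_lt_mul (by omega)

lemma extremalColor_lt {t m x y j : ℕ} (hx : x < t + m * j) (hy : y < t + m * j) :
    extremalColor t m x y < j + 3 := by
  have h1 := extremalLayer_le hx
  have h2 := extremalLayer_le hy
  unfold extremalColor
  split_ifs <;> omega

lemma extremalColor_triangle (t m x y z : ℕ) :
    extremalColor t m x y = extremalColor t m y z ∨
      extremalColor t m x y = extremalColor t m x z ∨
        extremalColor t m x z = extremalColor t m y z := by
  unfold extremalColor
  generalize extremalLayer t m x = a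
  generalize extremalLayer t m y = b
  generalize extremalLayer t m z = d
  grind

/-- A layer other than layer `0` has at most `m` vertices. -/
lemma card_le_of_extremalLayer_eq {t m j : ℕ} (hm : 1 ≤ m) (hj : 1 ≤ j) {A : Finset ℕ}
    (hA : ∀ a ∈ A, extremalLayer t m a = j) : A.card ≤ m := by
  have h : A ⊆ Finset.Ico (t + m * (j - 1)) (t + m * (j - 1) + m) := by
    intro a ha
    have h1 := hA a ha
    unfold extremalLayer at h1
    split_ifs at h1 with h2
    · omega
    · have h3 : (a - t) / m = j - 1 := by omega
      have h4 := (Nat.div_eq_iff (by omega)).1 h3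
      rw [mul_comm] at h4
      rw [Finset.mem_Ico]
      omega
  simpa using Finset.card_le_card h

/-- Each residue class mod `5` below `5q + e` has at most `q + e` elements, and only `q` if the
residue is not `0`. -/
lemma card_le_of_mod_five {q e r : ℕ} (he : e ≤ 1) {A : Finset ℕ}
    (hA : ∀ a ∈ A, a < 5 * q + e ∧ a % 5 = r) : A.card ≤ q + if r = 0 then e else 0 := by
  rw [← Finset.card_range (q + if r = 0 then e else 0)]
  refine Finset.card_le_card_of_injOn (· / 5) ?_ ?_
  · intro a ha
    have h := hA a ha
    simp only [Finset.coe_range, Set.mem_Iio]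
    split_ifs <;> omega
  · intro a ha b hb hab
    have h1 := hA a ha
    have h2 := hA b hb
    simp only at hab
    omega

/-- In colours other than those joining the layers, all degrees of the extremal colouring are at
most `n`. -/
lemma card_extremal_nbrs_le {n m u i : ℕ} (hmn : m ≤ n) (hm : 1 ≤ m) (hi : i ≤ 2)
    {A : Finset ℕ} (hA : ∀ a ∈ A, extremalColor (5 * (n / 2) + n % 2) m u a = i) :
    A.card ≤ n := by
  set t := 5 * (n / 2) + n % 2 with ht
  have he : n % 2 ≤ 1 := by omega
  have hlay : ∀ a ∈ A, extremalLayer t m a = extremalLayer t m u := by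
    intro a ha
    have h := hA a ha
    unfold extremalColor at h
    split_ifs at h <;> omega
  have hlt : extremalLayer t m u = 0 → ∀ a ∈ A, a < t := by
    intro h0 a ha
    have h := hlay a ha
    rw [h0] at h
    unfold extremalLayer at h
    split_ifs at h with h1
    exact h1
  -- The neighbours lie in two of the five residue classes.
  have htwo : ∀ r s : ℕ, r ≠ s → extremalLayer t m u = 0 → (∀ a ∈ A, a % 5 = r ∨ a % 5 = s) →
      A.card ≤ n := by
    intro r s hrs h0 hrsA
    have h1 : A ⊆ A.filter (· % 5 = r) ∪ A.filter (· % 5 = s) := by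
      intro a ha
      have := hrsA a ha
      simp only [Finset.mem_union, Finset.mem_filter]
      tauto
    have h2 := (Finset.card_le_card h1).trans (Finset.card_union_le _ _)
    have h3 := card_le_of_mod_five (q := n / 2) (r := r) he (A := A.filter (· % 5 = r))
      (fun a ha => ⟨hlt h0 a (Finset.mem_filter.1 ha).1, (Finset.mem_filter.1 ha).2⟩)
    have h4 := card_le_of_mod_five (q := n / 2) (r := s) he (A := A.filter (· % 5 = s))
      (fun a ha => ⟨hlt h0 a (Finset.mem_filter.1 ha).1, (Finset.mem_filter.1 ha).2⟩)
    split_ifs at h3 h4 <;> omega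
  by_cases h0 : extremalLayer t m u = 0
  · obtain rfl | rfl | rfl : i = 0 ∨ i = 1 ∨ i = 2 := by omega
    · refine htwo ((u + 1) % 5) ((u + 4) % 5) (by omega) h0 fun a ha => ?_
      have h := hA a ha
      unfold extremalColor at h
      split_ifs at h
      omega
    · refine htwo ((u + 2) % 5) ((u + 3) % 5) (by omega) h0 fun a ha => ?_
      have h := hA a ha
      unfold extremalColor at h
      split_ifs at h <;> omega
    · refine htwo (u % 5) ((u + 1) % 5) (by omega) h0 fun a ha => Or.inl ?_
      have h := hA a ha
      have h' := hlay a ha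
      unfold extremalColor at h
      split_ifs at h <;> omega
  · exact (card_le_of_extremalLayer_eq hm (by omega) hlay).trans hmn

/-- On at most `5⌊n/2⌋ + (n mod 2) + m(k - 3)` vertices, the extremal colouring has neither a
rainbow triangle nor a monochromatic `S(n,m)`. -/
theorem exists_coloring_of_le {n m k M : ℕ} (hmn : m ≤ n) (hm : 1 ≤ m) (hk : 3 ≤ k)
    (hM : M ≤ 5 * (n / 2) + n % 2 + m * (k - 3)) :
    ∃ C : SimpleGraph.TopEdgeLabeling (Fin M) (Fin k),
      ¬ HasRainbowCopy C (⊤ : SimpleGraph (Fin 3)) ∧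
        ¬ HasMonochromaticCopy C (doubleStar n m) := by
  set t := 5 * (n / 2) + n % 2 with ht
  have hlt : ∀ x y : Fin M, extremalColor t m x y < k := by
    intro x y
    have := extremalColor_lt (t := t) (m := m) (j := k - 3) (x := x) (y := y)
      (by omega) (by omega)
    omega
  let C : SimpleGraph.TopEdgeLabeling (Fin M) (Fin k) :=
    SimpleGraph.EdgeLabeling.mk (fun x y _ => ⟨extremalColor t m x y, hlt x y⟩)
      (fun x y _ => Fin.ext (extremalColor_comm t m y x))
  have hget : ∀ (x y : Fin M) (h : x ≠ y),
      C.get x y h = ⟨extremalColor t m x y, hlt x y⟩ := fun x y h => rfl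
  refine ⟨C, not_hasRainbowCopy_of_forall fun x y z hxy hyz hxz => ?_, ?_⟩
  · rw [hget, hget, hget]
    simpa only [Fin.mk.injEq] using extremalColor_triangle t m x y z
  · rintro ⟨i, hi⟩
    obtain ⟨u, v, huv, ⟨A, hAc, hA⟩, ⟨B, hBc, hB⟩⟩ := exists_card_le_of_isContained_doubleStar hi
    have hcol : ∀ {x y}, (C.labelGraph i).Adj x y → extremalColor t m x y = i := by
      intro x y h
      obtain ⟨h1, h2⟩ := (SimpleGraph.TopEdgeLabeling.labelGraph_adj x y).1 h
      rw [← h2]; rfl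
    have hA' : ∀ a ∈ A.map Fin.valEmbedding, extremalColor t m u a = i := by
      intro a ha
      obtain ⟨b, hb, rfl⟩ := Finset.mem_map.1 ha
      exact hcol (hA b hb)
    have hB' : ∀ a ∈ B.map Fin.valEmbedding, extremalColor t m v a = i := by
      intro a ha
      obtain ⟨b, hb, rfl⟩ := Finset.mem_map.1 ha
      exact hcol (hB b hb)
    by_cases hi2 : (i : ℕ) ≤ 2
    · have := card_extremal_nbrs_le hmn hm hi2 hA'
      rw [Finset.card_map] at this
      omega
    · -- The centre in the lower layer has all its neighbours in layer `i - 2`.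
      have key : ∀ w (D : Finset ℕ), extremalLayer t m w < i - 2 →
          (∀ a ∈ D, extremalColor t m w a = i) → D.card ≤ m := by
        intro w D hw hD
        refine card_le_of_extremalLayer_eq (t := t) (j := i - 2) hm (by omega) fun a ha => ?_
        have h := hD a ha
        unfold extremalColor at h
        split_ifs at h <;> omega
      have huv' := hcol huv
      have : extremalLayer t m u < i - 2 ∨ extremalLayer t m v < i - 2 := by
        unfold extremalColor at huv'
        split_ifs at huv' <;> omega
      rcases this with h | h
      · have := key u _ h hA'
        rw [Finset.card_map] at this
        omega
      · have := key v _ h hB'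
        rw [Finset.card_map] at this
        omega

/-! ### Gallai partitions -/

/-- The graph on `V` of the edges inside `S` whose colour is neither `r` nor `b`. -/
def otherGraph {V K : Type*} (c : V → V → K) (S : Finset V) (r b : K) : SimpleGraph V :=
  SimpleGraph.fromRel fun x y => x ∈ S ∧ y ∈ S ∧ c x y ≠ r ∧ c x y ≠ b

lemma otherGraph_adj {V K : Type*} {c : V → V → K} (hc : IsGallaiColoring c) {S : Finset V}
    {r b : K} {x y : V} : (otherGraph c S r b).Adj x y ↔
      x ≠ y ∧ x ∈ S ∧ y ∈ S ∧ c x y ≠ r ∧ c x y ≠ b := by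
  simp only [otherGraph, SimpleGraph.fromRel_adj, hc.symm y x]
  tauto

lemma color_of_not_reachable {V K : Type*} {c : V → V → K} (hc : IsGallaiColoring c)
    {S : Finset V} {r b : K} {x y : V} (hx : x ∈ S) (hy : y ∈ S)
    (h : ¬ (otherGraph c S r b).Reachable x y) : c x y = r ∨ c x y = b := by
  by_contra! hcon
  by_cases hxy : x = y
  · exact h (hxy ▸ SimpleGraph.Reachable.refl x)
  · exact h ((otherGraph_adj hc).2 ⟨hxy, hx, hy, hcon⟩).reachable

/-- Along an edge `xx'` of a colour other than `r`, `b`, the colours towards a vertex `y` outside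
the component must agree, or `xx'y` would be a rainbow triangle. -/
lemma color_eq_of_reachable {V K : Type*} {c : V → V → K} (hc : IsGallaiColoring c)
    {S : Finset V} {r b : K} {x x' y : V} (hx : x ∈ S) (hy : y ∈ S)
    (h : (otherGraph c S r b).Reachable x x') (hxy : ¬ (otherGraph c S r b).Reachable x y) :
    c x y = c x' y := by
  obtain ⟨w⟩ := h
  induction w with
  | nil => rfl
  | @cons x z x' hadj w ih =>
    obtain ⟨hxz, -, hz, h1, h2⟩ := (otherGraph_adj hc).1 hadj
    have hzy : ¬ (otherGraph c S r b).Reachable z y := fun h => hxy (hadj.reachable.trans h)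
    have hxy' : x ≠ y := fun h => hxy (h ▸ SimpleGraph.Reachable.refl x)
    have hzy' : z ≠ y := fun h => hzy (h ▸ SimpleGraph.Reachable.refl z)
    rw [← ih hz hzy]
    have h3 := color_of_not_reachable hc hx hy hxy
    have h4 := color_of_not_reachable hc hz hy hzy
    rcases hc.triangle x z y hxz hzy' hxy' with h | h | h
    · rw [h] at h1 h2; tauto
    · rw [h] at h1 h2; tauto
    · exact h

/-- Gallai's theorem: a complete graph with a Gallai colouring has a cut whose edges have at most
two colours. In the induction step a vertex `v` is added to a set with such a cut. If there
is no cut in two colours, then `v` sends edges of a single third colour `g` to each component of the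
edges coloured other than `r`, `b`, and also edges of both colours `r` and `b`; the latter
force the edges leaving their components to be entirely of colour `r`, and entirely of colour
`b`. -/
theorem IsGallaiColoring.exists_two_color_cut {V K : Type*} [DecidableEq V] {c : V → V → K}
    (hc : IsGallaiColoring c) (S : Finset V) (hS : 2 ≤ S.card) :
    ∃ r b, ∃ A ⊆ S, A.Nonempty ∧ (S \ A).Nonempty ∧
      ∀ x ∈ A, ∀ y ∈ S \ A, c x y = r ∨ c x y = b := by
  classical
  induction S using Finset.induction_on with
  | empty => simp at hS
  | insert v S hv ih =>
    rw [Finset.card_insert_of_notMem hv] at hS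
    have hsing : (insert v S) \ {v} = S := by
      ext a
      simp only [Finset.mem_sdiff, Finset.mem_insert, Finset.mem_singleton]
      grind
    by_cases h1 : S.card ≤ 1
    · obtain ⟨w, rfl⟩ := Finset.card_eq_one.1 (show S.card = 1 by omega)
      refine ⟨c v w, c v w, {v}, by simp, by simp, by simp [hsing], ?_⟩
      rw [hsing]
      simp
    obtain ⟨r, b, A, hAS, ⟨p, hp⟩, ⟨q, hq⟩, hA⟩ := ih (by omega)
    by_contra! hcut
    set G := otherGraph c S r b with hG
    have hpq : ¬ G.Reachable p q := by
      rintro ⟨w⟩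
      induction w with
      | nil => exact (Finset.mem_sdiff.1 hq).2 hp
      | @cons x z y hadj w ih =>
        obtain ⟨-, hx, hz, h1, h2⟩ := (otherGraph_adj hc).1 hadj
        refine ih ?_ hq
        by_contra hzA
        have := hA x hp z (Finset.mem_sdiff.2 ⟨hz, hzA⟩)
        tauto
    have hpS := hAS hp
    have hqS := (Finset.mem_sdiff.1 hq).1
    have hreach : ∀ w ∈ S, ∃ u ∈ S, G.Reachable w u ∧ c v u ≠ r ∧ c v u ≠ b := by
      intro w hw
      obtain ⟨x, hx, y, hy, h⟩ := hcut r b (S.filter fun u => G.Reachable w u)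
        ((Finset.filter_subset _ _).trans (Finset.subset_insert _ _))
        ⟨w, Finset.mem_filter.2 ⟨hw, SimpleGraph.Reachable.refl w⟩⟩
        ⟨v, Finset.mem_sdiff.2 ⟨Finset.mem_insert_self _ _, fun h => hv (Finset.mem_filter.1 h).1⟩⟩
      obtain ⟨hxS, hwx⟩ := Finset.mem_filter.1 hx
      obtain ⟨hy1, hy2⟩ := Finset.mem_sdiff.1 hy
      rcases Finset.mem_insert.1 hy1 with rfl | hyS
      · exact ⟨x, hxS, hwx, by rwa [hc.symm]⟩
      · have hxy : ¬ G.Reachable x y := fun h' =>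
          hy2 (Finset.mem_filter.2 ⟨hyS, hwx.trans h'⟩)
        have := color_of_not_reachable hc hxS hyS hxy
        tauto
    have hvne : ∀ {u}, u ∈ S → v ≠ u := fun hu h => hv (h ▸ hu)
    have hne : ∀ {x y}, ¬ G.Reachable x y → x ≠ y := fun h h' =>
      h (h' ▸ SimpleGraph.Reachable.refl _)
    have hsame : ∀ u ∈ S, ∀ u' ∈ S, ¬ G.Reachable u u' → c v u ≠ r → c v u ≠ b →
        c v u' ≠ r → c v u' ≠ b → c v u = c v u' := by
      intro u hu u' hu' huu' h1 h2 h3 h4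
      have h5 := color_of_not_reachable hc hu hu' huu'
      rcases hc.triangle v u u' (hvne hu) (hne huu') (hvne hu') with h | h | h
      · rw [h] at h1 h2; tauto
      · exact h
      · rw [h] at h3 h4; tauto
    obtain ⟨u₁, hu₁, hpu, h1r, h1b⟩ := hreach p hpS
    obtain ⟨u₂, hu₂, hqu, h2r, h2b⟩ := hreach q hqS
    have h12 : ¬ G.Reachable u₁ u₂ := fun h => hpq (hpu.trans (h.trans hqu.symm))
    set g := c v u₁ with hg
    have hg2 : c v u₂ = g := (hsame u₁ hu₁ u₂ hu₂ h12 h1r h1b h2r h2b).symm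
    have hall : ∀ u ∈ S, c v u ≠ r → c v u ≠ b → c v u = g := by
      intro u hu h3 h4
      by_cases h : G.Reachable u u₁
      · rw [← hg2]
        exact hsame u hu u₂ hu₂ (fun h' => h12 (h.symm.trans h')) h3 h4 h2r h2b
      · exact hsame u hu u₁ hu₁ h h3 h4 h1r h1b
    have hforce : ∀ y ∈ S, c v y ≠ g → ∀ w ∈ S, ¬ G.Reachable y w → c y w = c v y := by
      intro y hy hyg w hw hyw
      obtain ⟨u, hu, hwu, hur, hub⟩ := hreach w hw
      have hyu : ¬ G.Reachable y u := fun h => hyw (h.trans hwu.symm)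
      have h3 : c y w = c y u := by
        rw [hc.symm y w, hc.symm y u]
        exact color_eq_of_reachable hc hw hy hwu fun h => hyw h.symm
      have h4 := color_of_not_reachable hc hy hu hyu
      rw [h3]
      rcases hc.triangle v y u (hvne hy) (hne hyu) (hvne hu) with h | h | h
      · exact h.symm
      · exact absurd (h.trans (hall u hu hur hub)) hyg
      · rw [h] at hur hub; tauto
    have hstar : ∀ r' : K, ∃ y ∈ S, c v y ≠ r' ∧ c v y ≠ g := by
      intro r'
      obtain ⟨x, hx, y, hy, h⟩ := hcut r' g {v} (by simp) (by simp) (by rw [hsing]; exact ⟨p, hpS⟩)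
      rw [Finset.mem_singleton.1 hx] at h
      rw [hsing] at hy
      exact ⟨y, hy, h⟩
    obtain ⟨y, hy, hyr, hyg⟩ := hstar r
    obtain ⟨y', hy', hyb', hyg'⟩ := hstar b
    have hyb : c v y = b := by
      by_contra h
      exact hyg (hall y hy hyr h)
    have hyr' : c v y' = r := by
      by_contra h
      exact hyg' (hall y' hy' h hyb')
    by_cases hyy : G.Reachable y y'
    · have hw : ∃ w ∈ S, ¬ G.Reachable y w := by
        by_cases h : G.Reachable y p
        · exact ⟨q, hqS, fun h' => hpq (h.symm.trans h')⟩
        · exact ⟨p, hpS, h⟩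
      obtain ⟨w, hw, hyw⟩ := hw
      have h3 := hforce y hy hyg w hw hyw
      have h4 := hforce y' hy' hyg' w hw fun h => hyw (hyy.trans h)
      have h5 := color_eq_of_reachable hc hy hw hyy hyw
      exact hyb' (by rw [← h4, ← h5, h3, hyb])
    · have h3 := hforce y hy hyg y' hy' hyy
      have h4 := hforce y' hy' hyg' y hy fun h => hyy h.symm
      exact hyb' (by rw [← h4, hc.symm, h3, hyb])

/-- A Gallai partition of `S` in the colours `r ≠ b`, encoded by the equivalence relation `s`: there
are at least two classes, the edges between two given classes have the same colour, and this
colour is `r` or `b`. -/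
structure IsGallaiPartition {V K : Type*} (c : V → V → K) (S : Finset V) (s : Setoid V)
    (r b : K) : Prop where
  ne : r ≠ b
  color : ∀ x ∈ S, ∀ y ∈ S, ¬ s.r x y → c x y = r ∨ c x y = b
  homogeneous : ∀ x ∈ S, ∀ x' ∈ S, ∀ y ∈ S, s.r x x' → ¬ s.r x y → c x y = c x' y
  nontrivial : ∃ x ∈ S, ∃ y ∈ S, ¬ s.r x y

lemma IsGallaiPartition.swap {V K : Type*} {c : V → V → K} {S : Finset V} {s : Setoid V}
    {r b : K} (h : IsGallaiPartition c S s r b) : IsGallaiPartition c S s b r :=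
  ⟨h.ne.symm, fun x hx y hy hxy => (h.color x hx y hy hxy).symm, h.homogeneous, h.nontrivial⟩

theorem IsGallaiColoring.exists_gallaiPartition {V K : Type*} [DecidableEq V] [Nontrivial K]
    {c : V → V → K} (hc : IsGallaiColoring c) (S : Finset V) (hS : 2 ≤ S.card) :
    ∃ s r b, IsGallaiPartition c S s r b := by
  obtain ⟨r, b, A, hAS, ⟨p, hp⟩, ⟨q, hq⟩, hA⟩ := hc.exists_two_color_cut S hS
  obtain ⟨b', hne, hA'⟩ : ∃ b', r ≠ b' ∧ ∀ x ∈ A, ∀ y ∈ S \ A, c x y = r ∨ c x y = b' := by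
    by_cases h : r = b
    · obtain ⟨b', hb'⟩ := exists_ne r
      refine ⟨b', hb'.symm, fun x hx y hy => Or.inl ?_⟩
      have := hA x hx y hy
      rw [← h] at this
      tauto
    · exact ⟨b, h, hA⟩
  refine ⟨(otherGraph c S r b').reachableSetoid, r, b', hne, ?_, ?_, p, hAS hp, q,
    (Finset.mem_sdiff.1 hq).1, ?_⟩
  · exact fun x hx y hy h => color_of_not_reachable hc hx hy h
  · exact fun x hx x' _ y hy h h' => color_eq_of_reachable hc hx hy h h'
  · rintro ⟨w⟩
    induction w with
    | nil => exact (Finset.mem_sdiff.1 hq).2 hp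
    | @cons x z y hadj w ih =>
      obtain ⟨-, hx, hz, h1, h2⟩ := (otherGraph_adj hc).1 hadj
      refine ih ?_ hq
      by_contra hzA
      have := hA' x hp z (Finset.mem_sdiff.2 ⟨hz, hzA⟩)
      tauto

/-! ### Degrees in a Gallai partition -/

/-- The class of `x` in the partition of `S` given by `s`. -/
noncomputable def classIn {V : Type*} (S : Finset V) (s : Setoid V) (x : V) : Finset V := by
  classical exact S.filter (s.r x)

lemma mem_classIn {V : Type*} {S : Finset V} {s : Setoid V} {x y : V} :
    y ∈ classIn S s x ↔ y ∈ S ∧ s.r x y := by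
  simp [classIn]

lemma disjoint_classIn {V : Type*} {S : Finset V} {s : Setoid V} {x y : V} (h : ¬ s.r x y) :
    Disjoint (classIn S s x) (classIn S s y) := by
  rw [Finset.disjoint_left]
  intro a ha hb
  exact h (s.trans (mem_classIn.1 ha).2 (s.symm (mem_classIn.1 hb).2))

section GallaiPartition

variable {V K : Type*} [DecidableEq V] [DecidableEq K] {c : V → V → K} {S : Finset V}
  {s : Setoid V} {r b : K} {n m : ℕ}

lemma colorNbrs_mono {S T : Finset V} (h : S ⊆ T) (i : K) (x : V) :
    colorNbrs c S i x ⊆ colorNbrs c T i x :=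
  Finset.filter_subset_filter _ h

/-- `DoubleStarFree` with the roles of the two centres left open. -/
lemma DoubleStarFree.card_union_le (hF : DoubleStarFree c S n m) (hc : IsGallaiColoring c)
    {x y : V} (hx : x ∈ S) (hy : y ∈ S) (hxy : x ≠ y) {i : K} (hi : c x y = i)
    (h1 : m + 1 ≤ (colorNbrs c S i x).card) (h2 : m + 1 ≤ (colorNbrs c S i y).card)
    (h3 : n + 1 ≤ (colorNbrs c S i x).card ∨ n + 1 ≤ (colorNbrs c S i y).card) :
    (colorNbrs c S i x ∪ colorNbrs c S i y).card ≤ n + m + 1 := by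
  rcases h3 with h3 | h3
  · subst hi
    exact hF x hx y hy hxy h3 h2
  · rw [hc.symm] at hi
    subst hi
    rw [Finset.union_comm]
    exact hF y hy x hx hxy.symm h3 h1

lemma DoubleStarFree.card_le_of_card_ge (hF : DoubleStarFree c S n m) (hc : IsGallaiColoring c)
    {x y : V} (hx : x ∈ S) (hy : y ∈ S) (hxy : x ≠ y) {i : K} (hi : c x y = i)
    (h1 : n + m + 1 ≤ (colorNbrs c S i x).card) : (colorNbrs c S i y).card ≤ m := by
  by_contra! h2
  have h3 := hF.card_union_le hc hx hy hxy hi (by omega) h2 (Or.inl (by omega))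
  have h4 : insert x (colorNbrs c S i x) ⊆ colorNbrs c S i x ∪ colorNbrs c S i y := by
    intro a ha
    rcases Finset.mem_insert.1 ha with rfl | ha
    · exact Finset.mem_union_right _ (mem_colorNbrs.2 ⟨hx, hxy, by rwa [hc.symm]⟩)
    · exact Finset.mem_union_left _ ha
  have h5 := Finset.card_le_card h4
  rw [Finset.card_insert_of_notMem (fun h => (mem_colorNbrs.1 h).2.1 rfl)] at h5
  omega

namespace IsGallaiPartition

lemma class_subset_colorNbrs (hP : IsGallaiPartition c S s r b) (hc : IsGallaiColoring c) {x y : V}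
    (hx : x ∈ S) (hy : y ∈ S) (hxy : ¬ s.r x y) {i : K} (hi : c x y = i) :
    classIn S s y ⊆ colorNbrs c S i x := by
  intro z hz
  obtain ⟨hzS, hyz⟩ := mem_classIn.1 hz
  refine mem_colorNbrs.2 ⟨hzS, ?_, ?_⟩
  · rintro rfl
    exact hxy (s.symm hyz)
  · rw [hc.symm, ← hP.homogeneous y hy z hzS x hx hyz fun h => hxy (s.symm h), hc.symm, hi]

lemma subset_class_union (hP : IsGallaiPartition c S s r b) {x : V} (hx : x ∈ S) :
    S ⊆ classIn S s x ∪ (colorNbrs c S r x ∪ colorNbrs c S b x) := by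
  intro y hy
  by_cases h : s.r x y
  · exact Finset.mem_union_left _ (mem_classIn.2 ⟨hy, h⟩)
  · have hne : y ≠ x := fun h' => h (h' ▸ s.refl x)
    simp only [Finset.mem_union, mem_colorNbrs]
    have := hP.color x hx y hy h
    tauto

lemma card_le_class_add (hP : IsGallaiPartition c S s r b) {x : V} (hx : x ∈ S) :
    S.card ≤ (classIn S s x).card + ((colorNbrs c S r x).card + (colorNbrs c S b x).card) :=
  (Finset.card_le_card (hP.subset_class_union hx)).trans <|
    (Finset.card_union_le _ _).trans (Nat.add_le_add_left (Finset.card_union_le _ _) _)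

/-- In a large set with small classes, neither of the two colours of the partition has all degrees
at most `m`. -/
lemma exists_lt_card_colorNbrs (hP : IsGallaiPartition c S s r b) (hc : IsGallaiColoring c)
    (hF : DoubleStarFree c S n m) (hn : 6 * m + 7 ≤ n)
    (hcl : ∀ x ∈ S, (classIn S s x).card ≤ n + m) (hS : 2 * n + 3 ≤ S.card) :
    ∃ x ∈ S, m < (colorNbrs c S b x).card := by
  by_contra! hd
  by_cases hbig : ∃ z ∈ S, m + 1 ≤ (classIn S s z).card
  · obtain ⟨z, hz, hzc⟩ := hbig
    -- A class with more than `m` vertices is joined in colour `r` to everything outside it.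
    have hred : S \ classIn S s z ⊆ colorNbrs c S r z := by
      intro x hx
      obtain ⟨hxS, hxz⟩ := Finset.mem_sdiff.1 hx
      have hzx : ¬ s.r z x := fun h => hxz (mem_classIn.2 ⟨hxS, h⟩)
      refine mem_colorNbrs.2 ⟨hxS, fun h => hzx (h ▸ s.refl z), ?_⟩
      rcases hP.color z hz x hxS hzx with h | h
      · exact h
      · have h1 := Finset.card_le_card (hP.class_subset_colorNbrs hc hxS hz
          (fun h => hzx (s.symm h)) (hc.symm x z ▸ h))
        have := hd x hxS
        omega
    have h1 := Finset.card_le_card hred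
    have h2 := Finset.le_card_sdiff (classIn S s z) S
    have h3 := hcl z hz
    obtain ⟨x, hx⟩ : (S \ classIn S s z).Nonempty := Finset.card_pos.1 (by omega)
    obtain ⟨hxS, hxz, hcx⟩ := mem_colorNbrs.1 (hred hx)
    have hzx : ¬ s.r x z := fun h => (Finset.mem_sdiff.1 hx).2 (mem_classIn.2 ⟨hxS, s.symm h⟩)
    have h4 := hP.class_subset_colorNbrs hc hxS hz hzx (hc.symm x z ▸ hcx)
    have h5 := Finset.card_le_card h4
    have h6 : S ⊆ colorNbrs c S r z ∪ colorNbrs c S r x := by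
      intro a ha
      by_cases h : a ∈ classIn S s z
      · exact Finset.mem_union_right _ (h4 h)
      · exact Finset.mem_union_left _ (hred (Finset.mem_sdiff.2 ⟨ha, h⟩))
    have h7 := Finset.card_le_card h6
    have h8 := Finset.card_union_le (colorNbrs c S r z) (colorNbrs c S r x)
    have h9 := hF.card_union_le hc hz hxS hxz.symm hcx (by omega) (by omega) (by omega)
    omega
  · push Not at hbig
    have hdeg : ∀ z ∈ S, n + m + 1 ≤ (colorNbrs c S r z).card := by
      intro z hz
      have h1 := hP.card_le_class_add hz
      have h2 := hd z hz
      have h3 := hbig z hz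
      omega
    obtain ⟨z, hz⟩ : S.Nonempty := Finset.card_pos.1 (by omega)
    obtain ⟨x, hx⟩ : (colorNbrs c S r z).Nonempty := Finset.card_pos.1 (by have := hdeg z hz; omega)
    obtain ⟨hxS, hxz, hcx⟩ := mem_colorNbrs.1 hx
    have := hF.card_le_of_card_ge hc hz hxS hxz.symm hcx (hdeg z hz)
    have := hdeg x hxS
    omega

/-- A vertex of degree at most `m` in colour `b` lies in a class with at most `m` vertices. -/
lemma card_class_le_of_card_colorNbrs_le (hP : IsGallaiPartition c S s r b)
    (hc : IsGallaiColoring c) (hF : DoubleStarFree c S n m) (hn : 6 * m + 7 ≤ n)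
    (hcl : ∀ x ∈ S, (classIn S s x).card ≤ n + m) (hS : 2 * n + 2 * m + 3 ≤ S.card)
    {z : V} (hz : z ∈ S) (hd : (colorNbrs c S b z).card ≤ m) : (classIn S s z).card ≤ m := by
  by_contra! hbig
  have h1 : (S \ classIn S s z) \ colorNbrs c S b z ⊆ colorNbrs c S r z := by
    intro a ha
    simp only [Finset.mem_sdiff] at ha
    have := hP.subset_class_union hz ha.1.1
    simp only [Finset.mem_union] at this
    tauto
  have h2 := Finset.le_card_sdiff (colorNbrs c S b z) (S \ classIn S s z)
  have h3 := Finset.le_card_sdiff (classIn S s z) S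
  have h4 := Finset.card_le_card h1
  have h5 := hcl z hz
  obtain ⟨x, hx⟩ : ((S \ classIn S s z) \ colorNbrs c S b z).Nonempty :=
    Finset.card_pos.1 (by omega)
  obtain ⟨hxS, hxz, hcx⟩ := mem_colorNbrs.1 (h1 hx)
  have hzx : ¬ s.r x z := fun h =>
    (Finset.mem_sdiff.1 (Finset.mem_sdiff.1 hx).1).2 (mem_classIn.2 ⟨hxS, s.symm h⟩)
  have h6 := hP.class_subset_colorNbrs hc hxS hz hzx (hc.symm x z ▸ hcx)
  have h7 := Finset.card_le_card h6
  have h8 : S \ colorNbrs c S b z ⊆ colorNbrs c S r z ∪ colorNbrs c S r x := by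
    intro a ha
    obtain ⟨haS, hab⟩ := Finset.mem_sdiff.1 ha
    by_cases h : a ∈ classIn S s z
    · exact Finset.mem_union_right _ (h6 h)
    · exact Finset.mem_union_left _
        (h1 (Finset.mem_sdiff.2 ⟨Finset.mem_sdiff.2 ⟨haS, h⟩, hab⟩))
  have h9 := Finset.card_le_card h8
  have h10 := Finset.le_card_sdiff (colorNbrs c S b z) S
  have h11 := Finset.card_union_le (colorNbrs c S r z) (colorNbrs c S r x)
  have h12 := hF.card_union_le hc hz hxS hxz.symm hcx (by omega) (by omega) (by omega)
  omega

/-- All degrees in colour `r` exceed `m`. -/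
lemma lt_card_colorNbrs (hP : IsGallaiPartition c S s r b)
    (hc : IsGallaiColoring c) (hF : DoubleStarFree c S n m) (hn : 6 * m + 7 ≤ n)
    (hcl : ∀ x ∈ S, (classIn S s x).card ≤ n + m) (hS : 2 * n + 2 * m + 3 ≤ S.card)
    {z : V} (hz : z ∈ S) : m < (colorNbrs c S r z).card := by
  by_contra! hd
  have h1 := hP.swap.card_class_le_of_card_colorNbrs_le hc hF hn hcl hS hz hd
  have h2 := hP.card_le_class_add hz
  -- The neighbours of `z` in colour `b` have small degree in colour `b`, so large degree in
  -- colour `r`, and there are two of them joined in colour `r`.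
  have hU : ∀ u ∈ colorNbrs c S b z, (classIn S s u).card ≤ m ∧ (colorNbrs c S b u).card ≤ m := by
    intro u hu
    obtain ⟨huS, huz, hcu⟩ := mem_colorNbrs.1 hu
    have h3 := hF.card_le_of_card_ge hc hz huS huz.symm hcu (by omega)
    exact ⟨hP.card_class_le_of_card_colorNbrs_le hc hF hn hcl hS huS h3, h3⟩
  have hdeg : ∀ u ∈ colorNbrs c S b z, n + m + 1 ≤ (colorNbrs c S r u).card := by
    intro u hu
    obtain ⟨h3, h4⟩ := hU u hu
    have h5 := hP.card_le_class_add (mem_colorNbrs.1 hu).1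
    omega
  obtain ⟨u, hu⟩ : (colorNbrs c S b z).Nonempty := Finset.card_pos.1 (by omega)
  obtain ⟨h3, h4⟩ := hU u hu
  have huS := (mem_colorNbrs.1 hu).1
  have h5 := Finset.le_card_sdiff (classIn S s u ∪ colorNbrs c S b u) (colorNbrs c S b z)
  have h6 := Finset.card_union_le (classIn S s u) (colorNbrs c S b u)
  obtain ⟨x, hx⟩ : (colorNbrs c S b z \ (classIn S s u ∪ colorNbrs c S b u)).Nonempty :=
    Finset.card_pos.1 (by omega)
  obtain ⟨hxz, hx2⟩ := Finset.mem_sdiff.1 hx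
  have h7 := hP.subset_class_union huS (mem_colorNbrs.1 hxz).1
  have h8 : x ∈ colorNbrs c S r u := by
    simp only [Finset.mem_union] at h7 hx2
    tauto
  obtain ⟨hxS, hxu, hcx⟩ := mem_colorNbrs.1 h8
  have h9 := hF.card_le_of_card_ge hc huS hxS hxu.symm hcx (hdeg u hu)
  have := hdeg x hxz
  omega

/-- All degrees in colour `r` are at most `n`. -/
lemma card_colorNbrs_le (hP : IsGallaiPartition c S s r b)
    (hc : IsGallaiColoring c) (hF : DoubleStarFree c S n m) (hn : 6 * m + 7 ≤ n)
    (hcl : ∀ x ∈ S, (classIn S s x).card ≤ n + m) (hS : 2 * n + 2 * m + 3 ≤ S.card)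
    {v : V} (hv : v ∈ S) : (colorNbrs c S r v).card ≤ n := by
  by_contra! hd
  have hr := fun {z} (hz : z ∈ S) => hP.lt_card_colorNbrs hc hF hn hcl hS hz
  have hb := fun {z} (hz : z ∈ S) => hP.swap.lt_card_colorNbrs hc hF hn hcl hS hz
  have hcv := hcl v hv
  by_cases hX : ∃ w ∈ S, ¬ s.r v w ∧ c v w = r
  · obtain ⟨w, hw, hvw, hcw⟩ := hX
    have hwv : ¬ s.r w v := fun h => hvw (s.symm h)
    have h1 := hF.card_union_le hc hv hw (fun h => hvw (h ▸ s.refl v)) hcw (hr hv) (hr hw)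
      (Or.inl hd)
    -- The vertices missed by both neighbourhoods are joined to `v` in colour `b`.
    have h2 : S \ (colorNbrs c S r v ∪ colorNbrs c S r w) ⊆ colorNbrs c S b v := by
      intro a ha
      obtain ⟨haS, ha2⟩ := Finset.mem_sdiff.1 ha
      have h3 := hP.subset_class_union hv haS
      have h4 : a ∈ classIn S s v → a ∈ colorNbrs c S r w := fun h =>
        hP.class_subset_colorNbrs hc hw hv hwv (hc.symm w v ▸ hcw) h
      simp only [Finset.mem_union] at ha2 h3
      tauto
    have h3 := Finset.card_le_card h2
    have h4 := Finset.le_card_sdiff (colorNbrs c S r v ∪ colorNbrs c S r w) S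
    obtain ⟨z, hz⟩ : (colorNbrs c S b v).Nonempty := Finset.card_pos.1 (by omega)
    obtain ⟨hzS, hzv, hcz⟩ := mem_colorNbrs.1 hz
    have := hF.card_le_of_card_ge hc hv hzS hzv.symm hcz (by omega)
    have := hb hzS
    omega
  · push Not at hX
    have h1 : S \ classIn S s v ⊆ colorNbrs c S b v := by
      intro a ha
      obtain ⟨haS, hav⟩ := Finset.mem_sdiff.1 ha
      have hva : ¬ s.r v a := fun h => hav (mem_classIn.2 ⟨haS, h⟩)
      refine mem_colorNbrs.2 ⟨haS, fun h => hva (h ▸ s.refl v), ?_⟩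
      exact (hP.color v hv a haS hva).resolve_left (hX a haS hva)
    have h2 : colorNbrs c S r v ⊆ classIn S s v := by
      intro a ha
      obtain ⟨haS, hav, hca⟩ := mem_colorNbrs.1 ha
      by_contra hva
      exact hX a haS (fun h => hva (mem_classIn.2 ⟨haS, h⟩)) hca
    have h3 := Finset.card_le_card h2
    have h4 := Finset.le_card_sdiff (classIn S s v) S
    obtain ⟨y, hy⟩ : (S \ classIn S s v).Nonempty := Finset.card_pos.1 (by omega)
    obtain ⟨hyS, hyv, hcy⟩ := mem_colorNbrs.1 (h1 hy)
    have hyv' : ¬ s.r y v := fun h =>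
      (Finset.mem_sdiff.1 hy).2 (mem_classIn.2 ⟨hyS, s.symm h⟩)
    have h5 := hP.class_subset_colorNbrs hc hyS hv hyv' (hc.symm y v ▸ hcy)
    have h6 := Finset.card_le_card h5
    have h7 := hF.card_union_le hc hv hyS hyv.symm hcy (hb hv) (hb hyS) (Or.inr (by omega))
    have h8 : S ⊆ colorNbrs c S b v ∪ colorNbrs c S b y := by
      intro a ha
      by_cases h : a ∈ classIn S s v
      · exact Finset.mem_union_right _ (h5 h)
      · exact Finset.mem_union_left _ (h1 (Finset.mem_sdiff.2 ⟨ha, h⟩))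
    have h9 := Finset.card_le_card h8
    omega

end IsGallaiPartition

end GallaiPartition

/-! ### The pentagon structure -/

section Pentagon

variable {V K : Type*} [DecidableEq V] [DecidableEq K] {c : V → V → K} {S : Finset V}
  {s : Setoid V} {r b : K} {n m : ℕ}

namespace IsGallaiPartition

/-- The degree of a vertex `x'` in a class is at least its degree inside this class, plus the sizes
of any two classes joined to it in the same colour. -/
lemma card_add_card_add_card_le (hP : IsGallaiPartition c S s r b) (hc : IsGallaiColoring c)
    {i : K} {x x' y z : V} (hx' : x' ∈ classIn S s x) (hy : y ∈ S) (hz : z ∈ S)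
    (hxy : ¬ s.r x y) (hxz : ¬ s.r x z) (hyz : ¬ s.r y z) (hcy : c x y = i) (hcz : c x z = i)
    (hx : x ∈ S) :
    (classIn S s y).card + (classIn S s z).card + (colorNbrs c (classIn S s x) i x').card ≤
      (colorNbrs c S i x').card := by
  obtain ⟨hxS, hxx⟩ := mem_classIn.1 hx'
  have hxy' : ¬ s.r x' y := fun h => hxy (s.trans hxx h)
  have hxz' : ¬ s.r x' z := fun h => hxz (s.trans hxx h)
  have h1 := hP.class_subset_colorNbrs hc hxS hy hxy' (i := i)
    (by rw [← hcy]; exact (hP.homogeneous x hx x' hxS y hy hxx hxy).symm)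
  have h2 := hP.class_subset_colorNbrs hc hxS hz hxz' (i := i)
    (by rw [← hcz]; exact (hP.homogeneous x hx x' hxS z hz hxx hxz).symm)
  have h3 : colorNbrs c (classIn S s x) i x' ⊆ colorNbrs c S i x' :=
    colorNbrs_mono (fun a ha => (mem_classIn.1 ha).1) i x'
  have h4 : colorNbrs c (classIn S s x) i x' ⊆ classIn S s x := Finset.filter_subset _ _
  have hd1 := disjoint_classIn (S := S) hyz
  have hd2 : Disjoint (classIn S s y ∪ classIn S s z) (colorNbrs c (classIn S s x) i x') :=
    Finset.disjoint_of_subset_right h4 <| Finset.disjoint_union_left.2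
      ⟨disjoint_classIn fun h => hxy (s.symm h), disjoint_classIn fun h => hxz (s.symm h)⟩
  rw [← Finset.card_union_of_disjoint hd1, ← Finset.card_union_of_disjoint hd2]
  exact Finset.card_le_card (Finset.union_subset (Finset.union_subset h1 h2) h3)

/-- If classes are so large that three of them have more than `n` vertices, then in no colour is
there a class joined to three others. -/
lemma false_of_three (hP : IsGallaiPartition c S s r b) (hc : IsGallaiColoring c) {i : K}
    (hi : ∀ x ∈ S, (colorNbrs c S i x).card ≤ n) (hcl : ∀ x ∈ S, n < 3 * (classIn S s x).card)
    {x y z w : V} (hx : x ∈ S) (hy : y ∈ S) (hz : z ∈ S) (hw : w ∈ S) (hxy : ¬ s.r x y)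
    (hxz : ¬ s.r x z) (hxw : ¬ s.r x w) (hyz : ¬ s.r y z) (hyw : ¬ s.r y w) (hzw : ¬ s.r z w)
    (hcy : c x y = i) (hcz : c x z = i) (hcw : c x w = i) : False := by
  have h1 := hP.class_subset_colorNbrs hc hx hy hxy hcy
  have h2 := hP.class_subset_colorNbrs hc hx hz hxz hcz
  have h3 := hP.class_subset_colorNbrs hc hx hw hxw hcw
  have hd1 := disjoint_classIn (S := S) hyz
  have hd2 : Disjoint (classIn S s y ∪ classIn S s z) (classIn S s w) :=
    Finset.disjoint_union_left.2 ⟨disjoint_classIn hyw, disjoint_classIn hzw⟩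
  have h4 := Finset.card_le_card (Finset.union_subset (Finset.union_subset h1 h2) h3)
  rw [Finset.card_union_of_disjoint hd2, Finset.card_union_of_disjoint hd1] at h4
  have := hcl y hy
  have := hcl z hz
  have := hcl w hw
  have := hi x hx
  omega

/-- If all degrees in colour `r` are at most `n` and `S` has more than `2n` vertices, then two
classes joined in colour `r` have a common neighbour class in colour `b`. -/
lemma exists_common_nbr (hP : IsGallaiPartition c S s r b) (hc : IsGallaiColoring c)
    (hr : ∀ x ∈ S, (colorNbrs c S r x).card ≤ n) (hS : 2 * n < S.card) {x y : V} (hx : x ∈ S)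
    (hy : y ∈ S) (hxy : ¬ s.r x y) (hcxy : c x y = r) :
    ∃ z ∈ S, ¬ s.r x z ∧ ¬ s.r y z ∧ c x z = b ∧ c y z = b := by
  have hyx : ¬ s.r y x := fun h => hxy (s.symm h)
  have h1 := Finset.le_card_sdiff (colorNbrs c S r x ∪ colorNbrs c S r y) S
  have h2 := Finset.card_union_le (colorNbrs c S r x) (colorNbrs c S r y)
  have h3 := hr x hx
  have h4 := hr y hy
  obtain ⟨z, hz⟩ : (S \ (colorNbrs c S r x ∪ colorNbrs c S r y)).Nonempty :=
    Finset.card_pos.1 (by omega)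
  obtain ⟨hzS, hz2⟩ := Finset.mem_sdiff.1 hz
  rw [Finset.mem_union, not_or] at hz2
  have hxz : ¬ s.r x z := fun h => hz2.2
    (hP.class_subset_colorNbrs hc hy hx hyx (hc.symm y x ▸ hcxy) (mem_classIn.2 ⟨hzS, h⟩))
  have hyz : ¬ s.r y z := fun h => hz2.1
    (hP.class_subset_colorNbrs hc hx hy hxy hcxy (mem_classIn.2 ⟨hzS, h⟩))
  refine ⟨z, hzS, hxz, hyz, ?_, ?_⟩
  · exact (hP.color x hx z hzS hxz).resolve_left fun h =>
      hz2.1 (mem_colorNbrs.2 ⟨hzS, fun h' => hxz (h' ▸ s.refl x), h⟩)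
  · exact (hP.color y hy z hzS hyz).resolve_left fun h =>
      hz2.2 (mem_colorNbrs.2 ⟨hzS, fun h' => hyz (h' ▸ s.refl y), h⟩)

/-- If all degrees in the two colours are at most `n` and `S` is close to `5n/2` in size, then there
are exactly five classes, each joined to two classes in colour `r` and to the other two in colour
`b`. The conclusion is stated in terms of their sizes: the bound
`p j + p k + d ≤ n` holds for each class, its two neighbour classes `j` and `k` in either of the
colours, and any degree `d` in that colour inside the class. -/
lemma exists_pentagon (hP : IsGallaiPartition c S s r b) (hc : IsGallaiColoring c)
    (hn : 6 * m + 7 ≤ n)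
    (hr : ∀ x ∈ S, (colorNbrs c S r x).card ≤ n) (hb : ∀ x ∈ S, (colorNbrs c S b x).card ≤ n)
    (hS : 5 * n ≤ 2 * S.card + 2 * m + 1) :
    ∃ Q : Fin 5 → Finset V, (∀ i, Q i ⊆ S) ∧ (∀ i, (Q i).Nonempty) ∧
      S.card ≤ (Q 0).card + (Q 1).card + (Q 2).card + (Q 3).card + (Q 4).card ∧
      ∀ i, ∀ x ∈ Q i,
        (Q (i + 1)).card + (Q (i + 4)).card + (colorNbrs c (Q i) r x).card ≤ n ∧
        (Q (i + 2)).card + (Q (i + 3)).card + (colorNbrs c (Q i) b x).card ≤ n := by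
  have hcl : ∀ x ∈ S, n < 3 * (classIn S s x).card := by
    intro x hx
    have h1 := hP.card_le_class_add hx
    have h2 := hr x hx
    have h3 := hb x hx
    omega
  have hsymm : ∀ {x y}, ¬ s.r x y → ¬ s.r y x := fun h h' => h (s.symm h')
  have three := fun {x y z w} => @false_of_three V K _ _ c S s r b n hP hc r hr hcl x y z w
  have three' := fun {x y z w} => @false_of_three V K _ _ c S s r b n hP hc b hb hcl x y z w
  have hcolr : ∀ {x y}, x ∈ S → y ∈ S → ¬ s.r x y → c x y ≠ b → c x y = r :=
    fun hx hy h h' => (hP.color _ hx _ hy h).resolve_right h'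
  have hcolb : ∀ {x y}, x ∈ S → y ∈ S → ¬ s.r x y → c x y ≠ r → c x y = b :=
    fun hx hy h h' => (hP.color _ hx _ hy h).resolve_left h'
  -- Vertices with different colours to `z` are inequivalent.
  have hdiff : ∀ {x y z}, x ∈ S → y ∈ S → z ∈ S → ¬ s.r x z → c z x ≠ c z y → ¬ s.r x y :=
    fun {x y z} hx hy hz hxz h h' => h (by
      rw [hc.symm z x, hc.symm z y]; exact hP.homogeneous x hx y hy z hz h' hxz)
  -- An edge of colour `r` between classes exists, for otherwise an edge of colour `b` would have
  -- no common neighbour in colour `r`.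
  obtain ⟨u, hu, v, hv, huv, hcuv⟩ : ∃ u ∈ S, ∃ v ∈ S, ¬ s.r u v ∧ c u v = r := by
    obtain ⟨u, hu, v, hv, huv⟩ := hP.nontrivial
    rcases hP.color u hu v hv huv with h | h
    · exact ⟨u, hu, v, hv, huv, h⟩
    · obtain ⟨z, hz, huz, -, h1, -⟩ := hP.swap.exists_common_nbr hc hb (by omega) hu hv huv h
      exact ⟨u, hu, z, hz, huz, h1⟩
  obtain ⟨w, hw, huw, hvw, hcuw, hcvw⟩ := hP.exists_common_nbr hc hr (by omega) hu hv huv hcuv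
  obtain ⟨x, hx, hux, hwx, hcux, hcwx⟩ := hP.swap.exists_common_nbr hc hb (by omega) hu hw huw hcuw
  obtain ⟨y, hy, hvy, hwy, hcvy, hcwy⟩ := hP.swap.exists_common_nbr hc hb (by omega) hv hw hvw hcvw
  have hne := hP.ne
  have hvx : ¬ s.r v x := hdiff hv hx hw hvw (by
    rw [hcwx, hc.symm, hcvw]; exact hne.symm)
  have huy : ¬ s.r u y := hdiff hu hy hw huw (by
    rw [hcwy, hc.symm, hcuw]; exact hne.symm)
  have hxy : ¬ s.r x y := by
    intro h
    refine three hx hu hv hw (hsymm hux) (hsymm hvx) (hsymm hwx) huv huw hvw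
      (hc.symm x u ▸ hcux) ?_ (hc.symm x w ▸ hcwx)
    rw [hP.homogeneous x hx y hy v hv h (hsymm hvx), hc.symm, hcvy]
  have hcuy : c u y = b := hcolb hu hy huy fun h =>
    three hu hv hx hy huv hux huy hvx hvy hxy hcuv hcux h
  have hcvx : c v x = b := hcolb hv hx hvx fun h =>
    three hv hu hx hy (hsymm huv) hvx hvy hux huy hxy (hc.symm v u ▸ hcuv) h hcvy
  have hcxy : c x y = b := hcolb hx hy hxy fun h =>
    three hx hu hw hy (hsymm hux) (hsymm hwx) hxy huw huy hwy (hc.symm x u ▸ hcux)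
      (hc.symm x w ▸ hcwx) h
  have hcover : ∀ z ∈ S, s.r u z ∨ s.r v z ∨ s.r y z ∨ s.r w z ∨ s.r x z := by
    intro z hz
    by_contra! h
    obtain ⟨h1, h2, h3, h4, h5⟩ := h
    rcases hP.color u hu z hz h1 with h | h
    · exact three hu hv hx hz huv hux h1 hvx h2 h5 hcuv hcux h
    · exact three' hu hw hy hz huw huy h1 hwy h4 h3 hcuw hcuy h
  have sub : ∀ {x}, classIn S s x ⊆ S := fun {x} a ha => (mem_classIn.1 ha).1
  have key := fun {i x x' y z} (hx' : x' ∈ classIn S s x) hy hz hxy hxz hyz hcy hcz hx =>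
    @card_add_card_add_card_le V K _ _ c S s r b hP hc i x x' y z hx' hy hz hxy hxz hyz hcy hcz hx
  refine ⟨![classIn S s u, classIn S s v, classIn S s y, classIn S s w, classIn S s x], ?_, ?_, ?_,
    ?_⟩
  · intro i
    fin_cases i <;> exact sub
  · intro i
    fin_cases i
    · exact ⟨u, mem_classIn.2 ⟨hu, s.refl u⟩⟩
    · exact ⟨v, mem_classIn.2 ⟨hv, s.refl v⟩⟩
    · exact ⟨y, mem_classIn.2 ⟨hy, s.refl y⟩⟩
    · exact ⟨w, mem_classIn.2 ⟨hw, s.refl w⟩⟩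
    · exact ⟨x, mem_classIn.2 ⟨hx, s.refl x⟩⟩
  · have h1 : S ⊆ classIn S s u ∪ classIn S s v ∪ classIn S s y ∪ classIn S s w ∪
        classIn S s x := by
      intro z hz
      simp only [Finset.mem_union, mem_classIn, hz, true_and]
      have := hcover z hz
      tauto
    refine (Finset.card_le_card h1).trans ((Finset.card_union_le _ _).trans ?_)
    refine Nat.add_le_add_right ((Finset.card_union_le _ _).trans ?_) _
    refine Nat.add_le_add_right ((Finset.card_union_le _ _).trans ?_) _
    exact Nat.add_le_add_right (Finset.card_union_le _ _) _
  · intro i z hz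
    have hzS : z ∈ S := by fin_cases i <;> exact sub hz
    have hrz := hr z hzS
    have hbz := hb z hzS
    have e1 := hc.symm v u
    have e2 := hc.symm x u
    have e3 := hc.symm y v
    have e4 := hc.symm w u
    have e5 := hc.symm y u
    have e6 := hc.symm w v
    have e7 := hc.symm x v
    have e8 := hc.symm y x
    have e9 := hc.symm x w
    have e10 := hc.symm y w
    fin_cases i
    · exact ⟨(key hz hv hx huv hux hvx hcuv hcux hu).trans hrz,
        (key hz hy hw huy huw (hsymm hwy) hcuy hcuw hu).trans hbz⟩
    · exact ⟨(key hz hy hu hvy (hsymm huv) (hsymm huy) hcvy (e1.trans hcuv) hv).trans hrz,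
        (key hz hw hx hvw hvx hwx hcvw hcvx hv).trans hbz⟩
    · exact ⟨(key hz hw hv (hsymm hwy) (hsymm hvy) (hsymm hvw) (e10.trans hcwy) (e3.trans hcvy)
        hy).trans hrz,
        (key hz hx hu (hsymm hxy) (hsymm huy) (hsymm hux) (e8.trans hcxy) (e5.trans hcuy)
        hy).trans hbz⟩
    · exact ⟨(key hz hx hy hwx hwy hxy hcwx hcwy hw).trans hrz,
        (key hz hu hv (hsymm huw) (hsymm hvw) huv (e4.trans hcuw) (e6.trans hcvw) hw).trans hbz⟩
    · exact ⟨(key hz hu hw (hsymm hux) (hsymm hwx) huw (e2.trans hcux) (e9.trans hcwx)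
        hx).trans hrz,
        (key hz hv hy (hsymm hvx) hxy hvy (e7.trans hcvx) hcxy hx).trans hbz⟩

end IsGallaiPartition

/-- In a Gallai colouring of `p ≥ 2` vertices, some colour has a vertex of degree at least
`2p/5`. -/
lemma IsGallaiColoring.two_mul_card_le [Nontrivial K] (hc : IsGallaiColoring c) {d : ℕ}
    (hS : 2 ≤ S.card) (hd : ∀ i, ∀ x ∈ S, (colorNbrs c S i x).card ≤ d) :
    2 * S.card ≤ 5 * d := by
  by_contra! hlt
  obtain ⟨s, r, b, hP⟩ := hc.exists_gallaiPartition S hS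
  have hcl : ∀ x ∈ S, d < 2 * (classIn S s x).card := by
    intro x hx
    have h1 := hP.card_le_class_add hx
    have h2 := hd r x hx
    have h3 := hd b x hx
    omega
  have htwo : ∀ {x y z i}, x ∈ S → y ∈ S → z ∈ S → ¬ s.r x y → ¬ s.r x z → ¬ s.r y z →
      c x y = i → c x z = i → False := by
    intro x y z i hx hy hz hxy hxz hyz hcy hcz
    have h1 := hP.card_add_card_add_card_le hc (mem_classIn.2 ⟨hx, s.refl x⟩) hy hz hxy hxz hyz
      hcy hcz hx
    have := hd i x hx
    have := hcl y hy
    have := hcl z hz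
    omega
  have hsymm : ∀ {x y}, ¬ s.r x y → ¬ s.r y x := fun h h' => h (s.symm h')
  obtain ⟨x, hx, y, hy, hxy⟩ := hP.nontrivial
  have hxc := Finset.card_le_card (hP.class_subset_colorNbrs hc hy hx (hsymm hxy) rfl)
  have hyc := Finset.card_le_card (hP.class_subset_colorNbrs hc hx hy hxy rfl)
  have := hd (c x y) x hx
  have := hd (c y x) y hy
  by_cases hz : ∃ z ∈ S, ¬ s.r x z ∧ ¬ s.r y z
  · obtain ⟨z, hz, hxz, hyz⟩ := hz
    -- Three classes would be joined in three different colours, but only `r` and `b` occur.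
    have h1 : c x y ≠ c x z := fun h => htwo hx hy hz hxy hxz hyz h rfl
    have h2 : c x y ≠ c y z := fun h =>
      htwo hy hx hz (hsymm hxy) hyz hxz ((hc.symm y x).trans h) rfl
    have h3 : c x z ≠ c y z := fun h =>
      htwo hz hx hy (hsymm hxz) (hsymm hyz) hxy ((hc.symm z x).trans h) (hc.symm z y)
    have := hP.color x hx y hy hxy
    have := hP.color x hx z hz hxz
    have := hP.color y hy z hz hyz
    grind
  · push Not at hz
    have h1 : S ⊆ classIn S s x ∪ classIn S s y := by
      intro a ha
      by_cases h : s.r x a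
      · exact Finset.mem_union_left _ (mem_classIn.2 ⟨ha, h⟩)
      · exact Finset.mem_union_right _ (mem_classIn.2 ⟨ha, hz a ha h⟩)
    have h2 := (Finset.card_le_card h1).trans (Finset.card_union_le _ _)
    omega

end Pentagon

/-! ### Modules and the upper bound -/

/-- A module (homogeneous set) of an edge colouring: a set `H` such that every vertex outside `H` is
joined to all of `H` in a single colour. -/
def IsColorModule {V K : Type*} (c : V → V → K) (H : Finset V) : Prop :=
  ∀ u ∉ H, ∀ x ∈ H, ∀ y ∈ H, c u x = c u y

/-- A class of a Gallai partition of a module is a module. -/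
lemma IsGallaiPartition.isColorModule_classIn {V K : Type*} {c : V → V → K} {H : Finset V}
    {s : Setoid V} {r b : K} (hP : IsGallaiPartition c H s r b) (hc : IsGallaiColoring c)
    (hmod : IsColorModule c H) {x : V} :
    IsColorModule c (classIn H s x) := by
  intro u hu y hy z hz
  obtain ⟨hyH, hxy⟩ := mem_classIn.1 hy
  obtain ⟨hzH, hxz⟩ := mem_classIn.1 hz
  by_cases huH : u ∈ H
  · rw [hc.symm u y, hc.symm u z]
    exact hP.homogeneous y hyH z hzH u huH (s.trans (s.symm hxy) hxz) fun h =>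
      hu (mem_classIn.2 ⟨huH, s.trans hxy h⟩)
  · exact hmod u huH y hyH z hzH

/-- Let any two of five class sizes sum to at most `n`, and let them add up to at least
`(5n - 1)/2 - m`. Then the sizes cannot each be at most `5m/2` or have the other four sum to at
most `2n - m - 1`: two sizes of the first kind leave too much for the other three, and four of the
second kind bound the total from above. -/
lemma false_of_pentagon_sizes {n m p₀ p₁ p₂ p₃ p₄ : ℕ} (hn : 6 * m + 7 ≤ n)
    (hsum : 5 * n ≤ 2 * (p₀ + p₁ + p₂ + p₃ + p₄) + 2 * m + 1)
    (h0 : p₁ + p₄ ≤ n ∧ p₂ + p₃ ≤ n) (h1 : p₂ + p₀ ≤ n ∧ p₃ + p₄ ≤ n)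
    (h2 : p₃ + p₁ ≤ n ∧ p₄ + p₀ ≤ n) (h3 : p₄ + p₂ ≤ n ∧ p₀ + p₁ ≤ n)
    (h4 : p₀ + p₃ ≤ n ∧ p₁ + p₂ ≤ n)
    (i0 : 2 * p₀ ≤ 5 * m ∨ p₁ + p₄ + p₂ + p₃ + m + 1 ≤ 2 * n)
    (i1 : 2 * p₁ ≤ 5 * m ∨ p₂ + p₀ + p₃ + p₄ + m + 1 ≤ 2 * n)
    (i2 : 2 * p₂ ≤ 5 * m ∨ p₃ + p₁ + p₄ + p₀ + m + 1 ≤ 2 * n)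
    (i3 : 2 * p₃ ≤ 5 * m ∨ p₄ + p₂ + p₀ + p₁ + m + 1 ≤ 2 * n)
    (i4 : 2 * p₄ ≤ 5 * m ∨ p₀ + p₃ + p₁ + p₂ + m + 1 ≤ 2 * n) : False := by
  obtain ⟨h0, h0'⟩ := h0
  obtain ⟨h1, h1'⟩ := h1
  obtain ⟨h2, h2'⟩ := h2
  obtain ⟨h3, h3'⟩ := h3
  obtain ⟨h4, h4'⟩ := h4
  rcases i0 with i0 | i0 <;> rcases i1 with i1 | i1 <;> rcases i2 with i2 | i2 <;>
    rcases i3 with i3 | i3 <;> rcases i4 with i4 | i4 <;> linarith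

section UpperBound

variable {V K : Type*} [DecidableEq V] [DecidableEq K] {c : V → V → K} {n m : ℕ}

lemma DoubleStarFree.subset {S T : Finset V} (hF : DoubleStarFree c T n m) (hST : S ⊆ T) :
    DoubleStarFree c S n m := by
  intro x hx y hy hxy h1 h2
  have hsub := fun z => colorNbrs_mono (c := c) hST (c x y) z
  exact (Finset.card_le_card (Finset.union_subset_union (hsub x) (hsub y))).trans
    (hF x (hST hx) y (hST hy) hxy (h1.trans (Finset.card_le_card (hsub x)))
      (h2.trans (Finset.card_le_card (hsub y))))

/-- The colours in which some vertex outside `H` is joined to all of `H`. -/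
def outerColors [Fintype V] [Fintype K] (c : V → V → K) (H : Finset V) : Finset K :=
  Finset.univ.filter fun i => ∃ u ∉ H, ∀ x ∈ H, c u x = i

/-- A colour joining some outer vertex to a large module has degrees at most `m` at the vertices of
the module. -/
lemma card_colorNbrs_le_of_mem_outerColors [Fintype V] [Fintype K] (hc : IsGallaiColoring c)
    (hF : DoubleStarFree c Finset.univ n m) {H : Finset V} (hH : n + m + 1 ≤ H.card) {i : K}
    (hi : i ∈ outerColors c H) {x : V} (hx : x ∈ H) :
    (colorNbrs c Finset.univ i x).card ≤ m := by
  obtain ⟨u, hu, hui⟩ := (Finset.mem_filter.1 hi).2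
  refine hF.card_le_of_card_ge hc (Finset.mem_univ u) (Finset.mem_univ x)
    (fun h => hu (h ▸ hx)) (hui x hx) (hH.trans (Finset.card_le_card fun a ha => ?_))
  exact mem_colorNbrs.2 ⟨Finset.mem_univ a, fun h => hu (h ▸ ha), hui a ha⟩

/-- All but `m` vertices per outer colour belong to the module. -/
lemma card_le_card_add_outerColors [Fintype V] [Fintype K] (hc : IsGallaiColoring c)
    (hF : DoubleStarFree c Finset.univ n m) {H : Finset V} (hmod : IsColorModule c H)
    (hH : n + m + 1 ≤ H.card) :
    Fintype.card V ≤ H.card + m * (outerColors c H).card := by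
  obtain ⟨x, hx⟩ : H.Nonempty := Finset.card_pos.1 (by omega)
  have h1 : (Finset.univ : Finset V) ⊆
      H ∪ (outerColors c H).biUnion fun i => colorNbrs c Finset.univ i x := by
    intro u _
    by_cases hu : u ∈ H
    · exact Finset.mem_union_left _ hu
    · refine Finset.mem_union_right _ (Finset.mem_biUnion.2 ⟨c u x, ?_, ?_⟩)
      · exact Finset.mem_filter.2 ⟨Finset.mem_univ _, u, hu, fun y hy => hmod u hu y hy x hx⟩
      · exact mem_colorNbrs.2 ⟨Finset.mem_univ _, fun h => hu (h ▸ hx), hc.symm x u⟩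
  have h2 := (Finset.card_le_card h1).trans (Finset.card_union_le _ _)
  have h3 := Finset.card_biUnion_le_card_mul (outerColors c H)
    (fun i => colorNbrs c Finset.univ i x) m
    fun i hi => card_colorNbrs_le_of_mem_outerColors hc hF hH hi hx
  rw [Finset.card_univ] at h2
  rw [mul_comm] at h3
  omega

/-- A Gallai colouring without a monochromatic `S(n,m)` has at most
`5⌊n/2⌋ + (n mod 2) + m(k - 3)` vertices. -/
theorem card_lt_of_doubleStarFree [Fintype V] [Fintype K] (hm : 1 ≤ m) (hk : 3 ≤ Fintype.card K)
    (hn : 6 * m + 7 ≤ n) (hc : IsGallaiColoring c) (hF : DoubleStarFree c Finset.univ n m) :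
    Fintype.card V < 5 * (n / 2) + n % 2 + m * (Fintype.card K - 3) + 1 := by
  classical
  by_contra! hV
  have : Nontrivial K := Fintype.one_lt_card_iff_nontrivial.1 (by omega)
  obtain ⟨H, hHmem, hHmin⟩ := Finset.exists_min_image
    (Finset.univ.filter fun H : Finset V => IsColorModule c H ∧ n + m + 1 ≤ H.card) Finset.card
    ⟨Finset.univ, Finset.mem_filter.2 ⟨Finset.mem_univ _, fun u hu => absurd (Finset.mem_univ u) hu,
      by rw [Finset.card_univ]; omega⟩⟩
  obtain ⟨hmod, hH⟩ := (Finset.mem_filter.1 hHmem).2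
  have hcard := card_le_card_add_outerColors hc hF hmod hH
  have hFH := hF.subset (Finset.subset_univ H)
  obtain ⟨s, r, b, hP⟩ := hc.exists_gallaiPartition H (by omega)
  have hcl : ∀ x ∈ H, (classIn H s x).card ≤ n + m := by
    intro x hx
    by_contra! hlt
    have h1 := hHmin (classIn H s x) (Finset.mem_filter.2
      ⟨Finset.mem_univ _, hP.isColorModule_classIn hc hmod, hlt⟩)
    have h2 : classIn H s x = H :=
      Finset.eq_of_subset_of_card_le (fun a ha => (mem_classIn.1 ha).1) h1
    obtain ⟨y, hy, z, hz, hyz⟩ := hP.nontrivial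
    rw [← h2] at hy hz
    exact hyz (s.trans (s.symm (mem_classIn.1 hy).2) (mem_classIn.1 hz).2)
  have houter : ∀ i ∈ outerColors c H, ∀ x ∈ H, (colorNbrs c H i x).card ≤ m := fun i hi x hx =>
    (Finset.card_le_card (colorNbrs_mono (Finset.subset_univ H) i x)).trans
      (card_colorNbrs_le_of_mem_outerColors hc hF hH hi hx)
  obtain ⟨k, hk'⟩ : ∃ k, Fintype.card K = k + 3 := ⟨Fintype.card K - 3, by omega⟩
  rw [hk', Nat.add_sub_cancel] at hV
  set D := outerColors c H with hD
  have hDk : D.card ≤ k + 3 := hk' ▸ Finset.card_le_univ D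
  have hmD : m * D.card ≤ m * k + m * 3 := by
    rw [← mul_add]; exact Nat.mul_le_mul_left m hDk
  have hH2 : 2 * n + 3 ≤ H.card := by omega
  have hrD : r ∉ D := by
    intro h
    obtain ⟨x, hx, hlt⟩ := hP.swap.exists_lt_card_colorNbrs hc hFH hn hcl hH2
    exact absurd (houter r h x hx) (by omega)
  have hbD : b ∉ D := by
    intro h
    obtain ⟨x, hx, hlt⟩ := hP.exists_lt_card_colorNbrs hc hFH hn hcl hH2
    exact absurd (houter b h x hx) (by omega)
  have hcompl : {r, b} ⊆ Dᶜ := by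
    intro i hi
    rcases Finset.mem_insert.1 hi with rfl | hi
    · exact Finset.mem_compl.2 hrD
    · exact Finset.mem_compl.2 (Finset.mem_singleton.1 hi ▸ hbD)
  have hDc := Finset.card_le_card hcompl
  rw [Finset.card_pair hP.ne, Finset.card_compl, hk'] at hDc
  have hDk1 : D.card ≤ k + 1 := by omega
  have hmD1 : m * D.card ≤ m * k + m * 1 := by
    rw [← mul_add]; exact Nat.mul_le_mul_left m hDk1
  have hH3 : 2 * n + 2 * m + 3 ≤ H.card := by omega
  obtain ⟨Q, hQH, hQne, hQsum, hQ⟩ := hP.exists_pentagon (m := m) hc hn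
    (fun x hx => hP.card_colorNbrs_le hc hFH hn hcl hH3 hx)
    (fun x hx => hP.swap.card_colorNbrs_le hc hFH hn hcl hH3 hx) (by omega)
  have hpair : ∀ i, (Q (i + 1)).card + (Q (i + 4)).card ≤ n ∧
      (Q (i + 2)).card + (Q (i + 3)).card ≤ n := by
    intro i
    obtain ⟨x, hx⟩ := hQne i
    have := hQ i x hx
    omega
  have h0 : (Q 1).card + (Q 4).card ≤ n ∧ (Q 2).card + (Q 3).card ≤ n := hpair 0
  have h1 : (Q 2).card + (Q 0).card ≤ n ∧ (Q 3).card + (Q 4).card ≤ n := hpair 1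
  have h2 : (Q 3).card + (Q 1).card ≤ n ∧ (Q 4).card + (Q 0).card ≤ n := hpair 2
  have h3 : (Q 4).card + (Q 2).card ≤ n ∧ (Q 0).card + (Q 1).card ≤ n := hpair 3
  have h4 : (Q 0).card + (Q 3).card ≤ n ∧ (Q 1).card + (Q 2).card ≤ n := hpair 4
  by_cases hDk0 : D.card ≤ k
  · have hmD0 : m * D.card ≤ m * k := Nat.mul_le_mul_left m hDk0
    -- Any two of the five classes have together at most `n` vertices.
    omega
  · -- All colours but `r` and `b` are outer colours.
    have hDeq : {r, b} = Dᶜ := by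
      refine Finset.eq_of_subset_of_card_le hcompl ?_
      rw [Finset.card_pair hP.ne, Finset.card_compl, hk']
      omega
    have hinner : ∀ i, 2 * (Q i).card ≤ 5 * m ∨
        (Q (i + 1)).card + (Q (i + 4)).card + (Q (i + 2)).card + (Q (i + 3)).card + m + 1 ≤
          2 * n := by
      intro i
      by_contra! hcon
      obtain ⟨hbig, hsum⟩ := hcon
      have hp := hpair i
      refine absurd (hc.two_mul_card_le (S := Q i) (d := m) (by omega) ?_) (by omega)
      intro j x hx
      have h := hQ i x hx
      by_cases hj : j ∈ D
      · exact (Finset.card_le_card (colorNbrs_mono (hQH i) j x)).trans (houter j hj x (hQH i hx))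
      · have hj' : j ∈ ({r, b} : Finset K) := hDeq ▸ Finset.mem_compl.2 hj
        rcases Finset.mem_insert.1 hj' with rfl | hj'
        · omega
        · rw [Finset.mem_singleton.1 hj']
          omega
    have i0 : 2 * (Q 0).card ≤ 5 * m ∨
      (Q 1).card + (Q 4).card + (Q 2).card + (Q 3).card + m + 1 ≤ 2 * n := hinner 0
    have i1 : 2 * (Q 1).card ≤ 5 * m ∨
      (Q 2).card + (Q 0).card + (Q 3).card + (Q 4).card + m + 1 ≤ 2 * n := hinner 1
    have i2 : 2 * (Q 2).card ≤ 5 * m ∨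
      (Q 3).card + (Q 1).card + (Q 4).card + (Q 0).card + m + 1 ≤ 2 * n := hinner 2
    have i3 : 2 * (Q 3).card ≤ 5 * m ∨
      (Q 4).card + (Q 2).card + (Q 0).card + (Q 1).card + m + 1 ≤ 2 * n := hinner 3
    have i4 : 2 * (Q 4).card ≤ 5 * m ∨
      (Q 0).card + (Q 3).card + (Q 1).card + (Q 2).card + m + 1 ≤ 2 * n := hinner 4
    exact false_of_pentagon_sizes hn (by omega) h0 h1 h2 h3 h4 i0 i1 i2 i3 i4

end UpperBound

theorem mainTheorem1 (n m k : ℕ) (hm : 1 ≤ m) (hk : 3 ≤ k) (hn : 6 * m + 7 ≤ n) :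
    IsGallaiRamseyNumber k (⊤ : SimpleGraph (Fin 3)) (doubleStar n m)
      (if Even n then 5 * (n / 2) + m * (k - 3) + 1
        else 5 * ((n - 1) / 2) + m * (k - 3) + 2) := by
  have hN : (if Even n then 5 * (n / 2) + m * (k - 3) + 1
      else 5 * ((n - 1) / 2) + m * (k - 3) + 2) = 5 * (n / 2) + n % 2 + m * (k - 3) + 1 := by
    split_ifs with h
    · rw [Nat.even_iff.1 h]
      omega
    · have := Nat.odd_iff.1 (Nat.not_even_iff_odd.1 h)
      omega
  rw [hN]
  refine ⟨fun C => ?_, fun M hM => ?_⟩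
  · by_contra! hC
    have h := card_lt_of_doubleStarFree hm (by rwa [Fintype.card_fin]) hn
      (isGallaiColoring_labelFun hC.1 ⟨0, by omega⟩) (doubleStarFree_labelFun hC.2 ⟨0, by omega⟩)
    rw [Fintype.card_fin, Fintype.card_fin] at h
    exact lt_irrefl _ h
  · by_contra! hlt
    obtain ⟨C, hC1, hC2⟩ := exists_coloring_of_le (n := n) (m := m) (k := k) (M := M)
      (by omega) hm hk (by omega)
    exact (hM C).elim hC1 hC2
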